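/- Let $\mathfrak g=\mathfrak{saff}(2)=\langle\partial_x,\partial_y,x\partial_y,y\partial_x,x\partial_x-y\partial_y\rangle$ act on curves in $\mathbb C^2$, with jet coordinates $x,y=y_0,y_1,y_2,\dots$ (independent variable $x$), total derivative $D_x$, and prolongations $V^{(\infty)}$ of $V=\xi\partial_x+\varphi\partial_y\in\mathfrak g$. For $w\in\mathbb Z$ let $\mathcal R_w$ be the space of polynomials $R$ in the jet coordinates with $V^{(\infty)}(R)=w\,(\varphi_y-y_1\xi_y)\,R$ for all $V\in\mathfrak g$ (polynomial relative differential invariants of weight $w$; for $R\neq0$ this says that $R^{-1}(dy-y_1dx)^{\otimes w}$ is $\mathfrak g$-invariant), and let $\mathcal R=\bigoplus_{w\in\mathbb Z}\mathcal R_w$ be the graded algebra of polynomial relative differential invariants. A polynomial relative invariant derivation of weight $m$ is a derivation of $\mathcal R$ that is given on each $\mathcal R_w$ by $\alpha D_x+w\beta:\mathcal R_w\to\mathcal R_{w+m}$, with polynomials $\alpha,\beta$ in the jet coordinates that do not depend on $w$. Then: 1. $\Delta_w=y_2D_x-\frac w3y_3$ defines a polynomial relative invariant derivation $\Delta$ of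 weight $4$. 2. Every polynomial relative invariant derivation with $\alpha\ne0$ has weight $m\ge4$. If $\alpha=0$, then $\beta\in\mathcal R_m$, so that the derivation is just $R\mapsto w\beta R$ on $\mathcal R_w$. 3. There are $Q_{2i}\in\mathcal R_{5i-2}$, $i\ge2$, with $Q_4=3y_2y_4-5y_3^2$ and $$y_2\,Q_{2(i+1)}=\Delta^2(Q_{2i})+\tfrac{(5i-2)(5i+2)}{45}\,Q_4\,Q_{2i}\qquad(i\ge2),$$ and, for every $i\ge2$, $Q_{2i}=3y_2^{i-1}y_{2i}+\gamma_i(y_2,\dots,y_{2i-1})$ with a polynomial $\gamma_i$. 4. For every finite set of elements of $\mathcal R$ and every finite set of polynomial relative invariant derivations, the smallest $\mathbb C$-subalgebra of $\mathcal R$ that contains the former and is closed under the latter fails to contain some $Q_{2i}$, $i\ge2$; in particular it is not $\mathcal R$. Thus $\mathcal R$ is not finitely generated as a differential algebra, and without localization finite generation fails in general. -/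

import Mathlib

open MvPolynomial DirectSum

noncomputable section

namespace PlaneCurve

/-- Coordinates on the infinite jet space of curves in the plane, in the chart where `x` is the
independent variable: `none` is `x`, and `some k` is `y_k` (with `y_0 = y`). -/
abbrev JetCoord : Type := Option ℕ

/-- Polynomial functions in the jet coordinates `x, y, y_1, y_2, …` (each of finite order). -/
abbrev JetPoly : Type := MvPolynomial JetCoord ℂ

/-- The coordinate function `x`. -/
def xc : JetPoly := X none

/-- The coordinate function `y_k`; in particular `yc 0 = y`. -/
def yc (k : ℕ) : JetPoly := X (some k)

/-- The total derivative `D_x = ∂_x + ∑ y_{k+1} ∂_{y_k}`. -/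
def totalD : Derivation ℂ JetPoly JetPoly :=
  mkDerivation ℂ fun c => match c with
    | none => 1
    | some k => yc (k + 1)

/-- A vector field `ξ ∂_x + φ ∂_y`, given as the pair `(ξ, φ)`. Only those whose coefficients
depend on `x` and `y` alone are used. -/
abbrev PlaneField : Type := JetPoly × JetPoly

/-- The infinite prolongation of the point vector field `ξ ∂_x + φ ∂_y`, by the standard formula
`ξ D_x + ∑ D_x^k(φ - y_1 ξ) ∂_{y_k}`. -/
def prolong (V : PlaneField) : Derivation ℂ JetPoly JetPoly :=
  mkDerivation ℂ fun c => match c with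
    | none => V.1
    | some k => (totalD^[k]) (V.2 - yc 1 * V.1) + V.1 * yc (k + 1)

/-- The special affine algebra
`saff(2) = ⟨∂_x, ∂_y, x ∂_y, y ∂_x, x ∂_x - y ∂_y⟩` of vector fields in the plane. -/
def saff : Submodule ℂ PlaneField :=
  Submodule.span ℂ {(1, 0), (0, 1), (0, xc), (yc 0, 0), (xc, -yc 0)}

/-- The conformal factor of the contact form `ω = dy - y_1 dx` along `V = ξ ∂_x + φ ∂_y`, that is,
the function with `L_V ω = (∂_y φ - y_1 ∂_y ξ) ω`. -/
def contactFactor (V : PlaneField) : JetPoly :=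
  pderiv (some 0) V.2 - yc 1 * pderiv (some 0) V.1

/-- The space of polynomial relative differential invariants of weight `w` (with zero):
polynomials `R` with `V^{(∞)}(R) = w (∂_y φ - y_1 ∂_y ξ) R` for all `V ∈ saff(2)`, which says that
the tensor field `R⁻¹ (dy - y_1 dx)^{⊗ w}` is invariant where `R ≠ 0`. -/
def relInv (w : ℤ) : Submodule ℂ JetPoly where
  carrier := {R | ∀ V ∈ saff, prolong V R = (w : ℂ) • (contactFactor V * R)}
  add_mem' := by
    intro a b ha hb V hV
    rw [map_add, ha V hV, hb V hV, mul_add, smul_add]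
  zero_mem' := by
    intro V _
    simp
  smul_mem' := by
    intro c a ha V hV
    rw [Derivation.map_smul, ha V hV, mul_smul_comm, smul_comm]

instance relInv_gradedMonoid : SetLike.GradedMonoid relInv where
  one_mem := by
    intro V _
    simp
  mul_mem := by
    intro v w a b ha hb V hV
    rw [Derivation.leibniz, ha V hV, hb V hV]
    simp only [smul_eq_mul, MvPolynomial.smul_eq_C_mul, Int.cast_add, map_add]
    ring

/-- The graded algebra `⊕_w R_w` of polynomial relative differential invariants. -/
abbrev RelInv : Type := ⨁ w : ℤ, relInv w

/-- A relative invariant of weight `w` as an element of the graded algebra. -/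
abbrev homog (w : ℤ) (R : relInv w) : RelInv := DirectSum.of (fun w : ℤ => relInv w) w R

/-- The operator `α D_x + w β`. -/
def totalOp (α β : JetPoly) (w : ℤ) (R : JetPoly) : JetPoly :=
  α * totalD R + (w : ℂ) • (β * R)

/-- `δ` is the polynomial relative invariant derivation of weight `m` with polynomial coefficients
`α` and `β`: a derivation of the algebra of polynomial relative differential invariants that is
given on the component of each weight `w` by `α D_x + w β`, with values in the component of
weight `w + m`. -/
def IsRelInvDerivation (m : ℤ) (α β : JetPoly) (δ : Derivation ℂ RelInv RelInv) : Prop :=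
  ∀ (w : ℤ) (R : relInv w),
    ∃ h : totalOp α β w R ∈ relInv (w + m), δ (homog w R) = homog (w + m) ⟨totalOp α β w R, h⟩

/-- The differential subalgebra generated by a set `S` of elements and a set `T` of derivations:
the smallest subalgebra that contains `S` and is mapped to itself by every derivation in `T`. -/
def diffAdjoin (S : Set RelInv) (T : Set (Derivation ℂ RelInv RelInv)) : Subalgebra ℂ RelInv :=
  sInf {A | S ⊆ A ∧ ∀ δ ∈ T, ∀ a ∈ A, δ a ∈ A}

end PlaneCurve

end

open PlaneCurve

namespace PlaneCurve


/-! Write λ for the contact factor. Along `saff` one has D_x ξ = -λ, and D_x λ is a constant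
multiple of y₂. Hence y₂ has weight 3, while the failure of y₃, y₄ and D_x R to be relative
invariants is measured by D_x λ alone. These defects cancel in Q₄ and in Δ, and `secondOp` divides
Δ² + cQ₄ by y₂.

Conversely, applying αD_x + wβ to y₂ and Q₄ and eliminating β forces α ∈ R_{m-1}. Relative
invariants are polynomials in y₂, y₃, …, where scaling gives y_k the weight k + 1 ≥ 3; so α ≠ 0
leaves m ≥ 4 or m = 1, and m = 1 is excluded directly.

Non-finite generation rests on the monomials y₂ᵃ y_n. The condition n - a ≤ K for all n > K defines
a subalgebra (`slopeSubalgebra`). D_x raises n by one, but α has no constant term and so raises a by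
at least one; multiplication by β is harmless for large K (`totalOp_mem_slopeSubalgebra`). Finitely
many generators and derivations thus fit a common K, whereas Q_{2i} contains y₂^{i-1} y_{2i}, for
which n - a = i + 1 is unbounded. -/

theorem mem_relInv_iff {w : ℤ} {R : JetPoly} :
    R ∈ relInv w ↔ ∀ V ∈ saff, prolong V R = (w : JetPoly) * (contactFactor V * R) := by
  have h : ∀ F : JetPoly, (w : ℂ) • F = (w : JetPoly) * F := fun F => by
    rw [Int.cast_smul_eq_zsmul, zsmul_eq_mul]
  simp only [← h]
  rfl

theorem totalOp_eq (α β : JetPoly) (w : ℤ) (R : JetPoly) :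
    totalOp α β w R = α * totalD R + (w : JetPoly) * (β * R) := by
  rw [totalOp, Int.cast_smul_eq_zsmul, zsmul_eq_mul]

/-! ### Prolongation and the contact factor -/

@[simp] theorem totalD_xc : totalD xc = 1 := by simp [totalD, xc]

@[simp] theorem totalD_yc (k : ℕ) : totalD (yc k) = yc (k + 1) := by
  simp [totalD, yc]

@[simp] theorem prolong_xc (V : PlaneField) : prolong V xc = V.1 := by simp [prolong, xc]

theorem prolong_yc (V : PlaneField) (k : ℕ) :
    prolong V (yc k) = (totalD^[k]) (V.2 - yc 1 * V.1) + V.1 * yc (k + 1) := by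
  simp [prolong, yc]

/-- The prolongation commutes with the total derivative up to a multiple of it. -/
theorem prolong_totalD (V : PlaneField) (F : JetPoly) :
    prolong V (totalD F) = totalD (prolong V F) - totalD V.1 * totalD F := by
  have h : ⁅prolong V, totalD⁆ = -(totalD V.1 • totalD) := by
    apply MvPolynomial.derivation_ext
    rintro (_ | k)
    · rw [Derivation.commutator_apply]
      change prolong V (totalD xc) - totalD (prolong V xc) = -(totalD V.1 • totalD xc)
      simp
    · rw [Derivation.commutator_apply]
      change prolong V (totalD (yc k)) - totalD (prolong V (yc k)) = -(totalD V.1 • totalD (yc k))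
      rw [totalD_yc, prolong_yc, prolong_yc, Function.iterate_succ_apply', map_add,
        Derivation.leibniz, totalD_yc]
      simp only [smul_eq_mul]
      ring
  have h2 := congrArg (fun d => d F) h
  simp only [Derivation.commutator_apply, Derivation.neg_apply, Derivation.smul_apply,
    smul_eq_mul] at h2
  linear_combination h2

theorem contactFactor_add (V W : PlaneField) :
    contactFactor (V + W) = contactFactor V + contactFactor W := by
  simp only [contactFactor, Prod.fst_add, Prod.snd_add, map_add]
  ring

theorem contactFactor_smul (a : ℂ) (V : PlaneField) :
    contactFactor (a • V) = a • contactFactor V := by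
  simp only [contactFactor, Prod.smul_fst, Prod.smul_snd, Derivation.map_smul, mul_smul_comm,
    smul_sub]

theorem pderiv_zero_xc : pderiv (some 0) xc = 0 := by
  simp [xc, pderiv_X]

theorem pderiv_zero_yc_zero : pderiv (some 0) (yc 0) = 1 := by
  simp [yc]

theorem contactFactor_generators :
    contactFactor (1, 0) = 0 ∧ contactFactor (0, 1) = 0 ∧ contactFactor (0, xc) = 0 ∧
      contactFactor (yc 0, 0) = -yc 1 ∧ contactFactor (xc, -yc 0) = -1 := by
  simp [contactFactor, pderiv_zero_xc, pderiv_zero_yc_zero]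

theorem saff_induction {p : PlaneField → Prop} (h1 : p (1, 0)) (h2 : p (0, 1)) (h3 : p (0, xc))
    (h4 : p (yc 0, 0)) (h5 : p (xc, -yc 0)) (hadd : ∀ V W, p V → p W → p (V + W))
    (hsmul : ∀ (a : ℂ) V, p V → p (a • V)) {V : PlaneField} (hV : V ∈ saff) : p V := by
  refine Submodule.span_induction (p := fun V _ => p V) ?_ ?_ ?_ ?_ hV
  · rintro V (rfl | rfl | rfl | rfl | rfl) <;> assumption
  · simpa using hsmul 0 _ h1
  · exact fun V W _ _ => hadd V W
  · exact fun a V _ => hsmul a V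

/-- The sum D_x ξ + λ is the divergence ξ_x + φ_y, which vanishes on `saff`. -/
theorem totalD_fst {V : PlaneField} (hV : V ∈ saff) : totalD V.1 = -contactFactor V := by
  obtain ⟨c1, c2, c3, c4, c5⟩ := contactFactor_generators
  refine saff_induction (p := fun V => totalD V.1 = -contactFactor V) ?_ ?_ ?_ ?_ ?_ ?_ ?_ hV
  · simp [c1]
  · simp [c2]
  · simp [c3]
  · simp [c4]
  · simp [c5]
  · intro V W h h'
    rw [contactFactor_add, Prod.fst_add, map_add, h, h']
    ring
  · intro a V h
    rw [contactFactor_smul, Prod.smul_fst, Derivation.map_smul, h, smul_neg]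

/-- Since λ is a combination of 1 and y₁, the quotient D_x λ / y₂ is constant; this is its
derivative with denominators cleared. -/
theorem totalD_totalD_contactFactor {V : PlaneField} (hV : V ∈ saff) :
    totalD (totalD (contactFactor V)) * yc 2 = totalD (contactFactor V) * yc 3 := by
  obtain ⟨c1, c2, c3, c4, c5⟩ := contactFactor_generators
  refine saff_induction (p := fun V => totalD (totalD (contactFactor V)) * yc 2 =
    totalD (contactFactor V) * yc 3) ?_ ?_ ?_ ?_ ?_ ?_ ?_ hV
  · simp [c1]
  · simp [c2]
  · simp [c3]
  · simp [c4, mul_comm]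
  · simp [c5]
  · intro V W h h'
    simp only [contactFactor_add, map_add, add_mul, h, h']
  · intro a V h
    simp only [contactFactor_smul, Derivation.map_smul, smul_mul_assoc, h]

/-- For an affine field the coefficient of ∂_{y₂} is y₂(φ_y - y₁ξ_y - 2D_x ξ), and D_x ξ = -λ. -/
theorem prolong_yc_two {V : PlaneField} (hV : V ∈ saff) :
    prolong V (yc 2) = 3 * (contactFactor V * yc 2) := by
  obtain ⟨c1, c2, c3, c4, c5⟩ := contactFactor_generators
  refine saff_induction (p := fun V => prolong V (yc 2) = 3 * (contactFactor V * yc 2))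
    ?_ ?_ ?_ ?_ ?_ ?_ ?_ hV
  · simp [c1, prolong_yc]
  · simp [c2, prolong_yc]
  · simp [c3, prolong_yc]
  · simp only [c4, prolong_yc, Function.iterate_succ, Function.iterate_zero, Function.comp,
      map_sub, map_add, map_zero, Derivation.leibniz, totalD_yc, smul_eq_mul, id]
    ring
  · simp only [c5, prolong_yc, Function.iterate_succ, Function.iterate_zero, Function.comp,
      map_sub, map_neg, map_add, Derivation.leibniz, totalD_yc, totalD_xc, smul_eq_mul, id,
      Derivation.map_one_eq_zero]
    ring
  · intro V W h h'
    have : prolong (V + W) (yc 2) = prolong V (yc 2) + prolong W (yc 2) := by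
      simp only [prolong_yc, Function.iterate_succ, Function.iterate_zero, Function.comp, id,
        Prod.fst_add, Prod.snd_add, mul_add, map_sub, map_add]
      ring
    rw [this, h, h', contactFactor_add]
    ring
  · intro a V h
    have : prolong (a • V) (yc 2) = a • prolong V (yc 2) := by
      simp only [prolong_yc, Function.iterate_succ, Function.iterate_zero, Function.comp, id,
        Prod.smul_fst, Prod.smul_snd, mul_smul_comm, map_sub, Derivation.map_smul, smul_add,
        smul_sub, smul_mul_assoc]
    rw [this, h, contactFactor_smul, smul_mul_assoc, mul_smul_comm]

theorem prolong_totalD_of_mem {V : PlaneField} (hV : V ∈ saff) (F : JetPoly) :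
    prolong V (totalD F) = totalD (prolong V F) + contactFactor V * totalD F := by
  rw [prolong_totalD, totalD_fst hV]
  ring

theorem prolong_yc_three {V : PlaneField} (hV : V ∈ saff) :
    prolong V (yc 3) = 3 * (totalD (contactFactor V) * yc 2) + 4 * (contactFactor V * yc 3) := by
  have h := prolong_totalD_of_mem hV (yc 2)
  have h3 : totalD (3 : JetPoly) = 0 := Derivation.map_natCast totalD 3
  simp only [totalD_yc, prolong_yc_two hV, Derivation.leibniz, smul_eq_mul, h3] at h
  linear_combination h

theorem prolong_yc_four {V : PlaneField} (hV : V ∈ saff) :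
    prolong V (yc 4) = 10 * (totalD (contactFactor V) * yc 3) + 5 * (contactFactor V * yc 4) := by
  have h := prolong_totalD_of_mem hV (yc 3)
  have h3 : totalD (3 : JetPoly) = 0 := Derivation.map_natCast totalD 3
  have h4 : totalD (4 : JetPoly) = 0 := Derivation.map_natCast totalD 4
  simp only [totalD_yc, prolong_yc_three hV, Derivation.leibniz, smul_eq_mul, h3, h4, map_add] at h
  linear_combination h + 3 * totalD_totalD_contactFactor hV

/-! ### The invariants y₂ and Q₄, and the operator Δ -/

theorem yc_two_mem : yc 2 ∈ relInv 3 :=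
  mem_relInv_iff.2 fun V hV => by rw [prolong_yc_two hV]; norm_cast

/-- The relative invariant `Q₄` of weight `8`; it vanishes on parabolas. -/
noncomputable def quartic : JetPoly := 3 * yc 2 * yc 4 - 5 * yc 3 ^ 2

/-- The coefficients 3 and -5 make the D_x λ terms cancel: 3 · 10 = 5 · 2 · 3. -/
theorem quartic_mem : quartic ∈ relInv 8 := by
  refine mem_relInv_iff.2 fun V hV => ?_
  have h3 : prolong V (3 : JetPoly) = 0 := Derivation.map_natCast _ 3
  have h5 : prolong V (5 : JetPoly) = 0 := Derivation.map_natCast _ 5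
  simp only [quartic, map_sub, Derivation.leibniz, smul_eq_mul, h3, h5, pow_two,
    prolong_yc_two hV, prolong_yc_three hV, prolong_yc_four hV]
  push_cast
  ring

theorem mul_mem_relInv {v w : ℤ} {P R : JetPoly} (hP : P ∈ relInv v) (hR : R ∈ relInv w) :
    P * R ∈ relInv (v + w) := SetLike.GradedMul.mul_mem hP hR

/-- Leibniz rule and cancellation of P. This is how polynomial quotients, such as `secondOp` and the
coefficient α, are recognized as relative invariants. -/
theorem mem_relInv_of_mul_mem {v w : ℤ} {P R : JetPoly} (hP : P ∈ relInv v) (h0 : P ≠ 0)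
    (h : P * R ∈ relInv (v + w)) : R ∈ relInv w := by
  refine mem_relInv_iff.2 fun V hV => ?_
  have h1 := mem_relInv_iff.1 h V hV
  rw [Derivation.leibniz, mem_relInv_iff.1 hP V hV] at h1
  rw [smul_eq_mul, smul_eq_mul, Int.cast_add] at h1
  apply mul_left_cancel₀ h0
  linear_combination h1

theorem three_mul_C_third : (3 : JetPoly) * C (-(1 / 3 : ℂ)) = -1 := by
  rw [← map_ofNat C 3, ← C_mul]
  norm_num

/-- Prolonging D_x R produces the defect w R D_x λ, and prolonging y₃ produces 3 y₂ D_x λ; the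
factor -w/3 balances them. -/
theorem totalOp_standard_mem {w : ℤ} {R : JetPoly} (hR : R ∈ relInv w) :
    totalOp (yc 2) (C (-(1 / 3 : ℂ)) * yc 3) w R ∈ relInv (w + 4) := by
  refine mem_relInv_iff.2 fun V hV => ?_
  have hR := mem_relInv_iff.1 hR V hV
  have hC : prolong V (C (-(1 / 3 : ℂ))) = 0 := Derivation.map_algebraMap _ _
  have hw : prolong V (w : JetPoly) = 0 := Derivation.map_intCast _ _
  have hw' : totalD (w : JetPoly) = 0 := Derivation.map_intCast _ _
  rw [totalOp_eq]
  simp only [map_add, Derivation.leibniz, smul_eq_mul, hC, hw, hR, prolong_totalD_of_mem hV,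
    prolong_yc_two hV, prolong_yc_three hV, hw']
  push_cast
  linear_combination w * totalD (contactFactor V) * yc 2 * R * three_mul_C_third


/-! ### Δ as a derivation of the graded algebra -/

theorem homog_eq_homog {v w : ℤ} (h : v = w) {P Q : JetPoly} (hP : P ∈ relInv v)
    (hQ : Q ∈ relInv w) (hPQ : P = Q) : homog v ⟨P, hP⟩ = homog w ⟨Q, hQ⟩ := by
  subst h hPQ
  rfl

theorem homog_mul_homog {i j : ℤ} (P : relInv i) (Q : relInv j) :
    homog i P * homog j Q = homog (i + j) ⟨P * Q, mul_mem_relInv P.2 Q.2⟩ := by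
  have h := DirectSum.of_mul_of (A := fun w : ℤ => relInv w) P Q
  exact h

/-- The operator `y₂ D_x - (w/3) y₃` on the relative invariants of weight `w`. -/
noncomputable def standardOp (w : ℤ) : relInv w →ₗ[ℂ] relInv (w + 4) where
  toFun R := ⟨totalOp (yc 2) (C (-(1 / 3 : ℂ)) * yc 3) w R, totalOp_standard_mem R.2⟩
  map_add' R R' := by
    ext1
    simp only [totalOp_eq, Submodule.coe_add, map_add]
    ring
  map_smul' a R := by
    ext1
    simp only [totalOp_eq, Submodule.coe_smul, Derivation.map_smul, mul_smul_comm, RingHom.id_apply,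
      smul_add]

/-- The sum of the operators `y₂ D_x - (w/3) y₃` over all weights. -/
noncomputable def standardLinear : RelInv →ₗ[ℂ] RelInv :=
  DirectSum.toModule ℂ ℤ RelInv fun w =>
    (DirectSum.lof ℂ ℤ (fun w : ℤ => relInv w) (w + 4)).comp (standardOp w)

theorem standardLinear_homog (w : ℤ) (R : relInv w) :
    standardLinear (homog w R) = homog (w + 4) (standardOp w R) :=
  DirectSum.toModule_lof ℂ (M := fun w : ℤ => relInv w)
    (φ := fun w => (DirectSum.lof ℂ ℤ (fun w : ℤ => relInv w) (w + 4)).comp (standardOp w)) w R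

theorem standardLinear_mul (a b : RelInv) :
    standardLinear (a * b) = a * standardLinear b + b * standardLinear a := by
  induction a using DirectSum.induction_on with
  | zero => rw [zero_mul, map_zero, zero_mul, mul_zero, add_zero]
  | add x y hx hy =>
    rw [add_mul, map_add, map_add, hx, hy, add_mul, mul_add]
    exact add_add_add_comm _ _ _ _
  | of v R =>
    induction b using DirectSum.induction_on with
    | zero => rw [mul_zero, map_zero, zero_mul, mul_zero, add_zero]
    | add x y hx hy =>
      rw [mul_add, map_add, map_add, hx, hy, add_mul, mul_add]
      exact add_add_add_comm _ _ _ _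
    | of w R' =>
      rw [homog_mul_homog, standardLinear_homog, standardLinear_homog, standardLinear_homog,
        homog_mul_homog, homog_mul_homog]
      -- The two Leibniz terms live in components indexed by v + (w + 4) and w + (v + 4); both are
      -- transported to v + w + 4.
      have m1 := (mul_mem_relInv R.2 (standardOp w R').2)
      have m2 := (mul_mem_relInv R'.2 (standardOp v R).2)
      rw [show v + (w + 4) = v + w + 4 by ring] at m1
      rw [show w + (v + 4) = v + w + 4 by ring] at m2
      rw [homog_eq_homog (show v + (w + 4) = v + w + 4 by ring) _ m1 rfl,
        homog_eq_homog (show w + (v + 4) = v + w + 4 by ring) _ m2 rfl]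
      rw [homog, ← map_add]
      congr 1
      ext1
      simp only [standardOp, LinearMap.coe_mk, AddHom.coe_mk, totalOp_eq, Derivation.leibniz,
        Submodule.coe_add, smul_eq_mul, Int.cast_add]
      ring

/-- The relative invariant derivation of weight `4` given by `y₂ D_x - (w/3) y₃`. -/
noncomputable def standardDerivation : Derivation ℂ RelInv RelInv where
  toLinearMap := standardLinear
  map_one_eq_zero' := by
    have h := standardLinear_mul 1 1
    rw [mul_one, one_mul] at h
    refine DFinsupp.ext fun w => ?_
    have hw := DFunLike.congr_fun h w
    rw [DirectSum.add_apply] at hw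
    exact left_eq_add.1 hw
  leibniz' := standardLinear_mul

theorem isRelInvDerivation_standardDerivation :
    IsRelInvDerivation 4 (yc 2) (C (-(1 / 3 : ℂ)) * yc 3) standardDerivation :=
  fun w R => ⟨totalOp_standard_mem R.2, standardLinear_homog w R⟩


/-! ### The sequence Q₄, Q₆, … and its leading terms -/

/-- The quotient by `y₂` of `Δ² R + w (w + 4) / 45 Q₄ R`, for `R` of weight `w`. -/
noncomputable def secondOp (w : ℤ) (R : JetPoly) : JetPoly :=
  yc 2 * totalD (totalD R) - (C (1 / 45 : ℂ) : JetPoly) * (15 * (2 * w + 1)) * yc 3 * totalD R +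
    (C (1 / 45 : ℂ) : JetPoly) * (3 * (w * (w - 1))) * yc 4 * R

/-- Modulo y₂, Δ²R is w(w + 4)/9 · y₃²R and Q₄ is -5y₃², so the constant w(w + 4)/45 is what makes
the sum divisible by y₂. -/
theorem yc_two_mul_secondOp (w : ℤ) (R : JetPoly) :
    yc 2 * secondOp w R =
      totalOp (yc 2) (C (-(1 / 3 : ℂ)) * yc 3) (w + 4)
        (totalOp (yc 2) (C (-(1 / 3 : ℂ)) * yc 3) w R) +
      C ((w : ℂ) * (w + 4) / 45) * quartic * R := by
  have h45 : (45 : JetPoly) * C (1 / 45 : ℂ) = 1 := by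
    rw [← map_ofNat C 45, ← C_mul]
    norm_num
  have h3 : C (-(1 / 3 : ℂ)) = -15 * (C (1 / 45 : ℂ) : JetPoly) := by
    rw [← map_ofNat C 15, ← C_neg, ← C_mul]
    norm_num
  have hw : (C ((w : ℂ) * (w + 4) / 45) : JetPoly) =
      (C (1 / 45 : ℂ) : JetPoly) * ((w : JetPoly) * (w + 4)) := by
    rw [div_eq_mul_inv, C_mul, C_mul, C_add, map_intCast, map_ofNat, one_div]
    ring
  have hD : totalD (C (-(1 / 3 : ℂ))) = 0 := Derivation.map_algebraMap _ _
  have hw' : totalD (w : JetPoly) = 0 := Derivation.map_intCast _ _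
  rw [hw, totalOp_eq, totalOp_eq]
  simp only [map_add, Derivation.leibniz, hD, hw', smul_eq_mul, totalD_yc, secondOp, quartic]
  rw [h3]
  push_cast
  linear_combination (yc 2 * yc 3 * totalD R -
    5 * C (1 / 45 : ℂ) * w * (w + 4) * yc 3 ^ 2 * R) * h45

theorem yc_ne_zero (k : ℕ) : yc k ≠ 0 := X_ne_zero _

theorem secondOp_mem {w : ℤ} {R : JetPoly} (hR : R ∈ relInv w) :
    secondOp w R ∈ relInv (w + 5) := by
  apply mem_relInv_of_mul_mem yc_two_mem (yc_ne_zero 2)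
  rw [yc_two_mul_secondOp, show 3 + (w + 5) = w + 4 + 4 by ring]
  refine add_mem (totalOp_standard_mem (totalOp_standard_mem hR)) ?_
  rw [mul_assoc, ← smul_eq_C_mul]
  refine Submodule.smul_mem _ _ ?_
  rw [show w + 4 + 4 = 8 + w by ring]
  exact mul_mem_relInv quartic_mem hR

/-- The polynomials in `y₂, …, y_m`. -/
noncomputable abbrev jetSupported (m : ℕ) : Subalgebra ℂ JetPoly :=
  MvPolynomial.supported ℂ ((some : ℕ → JetCoord) '' Set.Icc 2 m)

theorem yc_mem_jetSupported {k m : ℕ} (h2 : 2 ≤ k) (hk : k ≤ m) : yc k ∈ jetSupported m :=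
  X_mem_supported.2 ⟨k, ⟨h2, hk⟩, rfl⟩

theorem jetSupported_mono {m n : ℕ} (h : m ≤ n) : jetSupported m ≤ jetSupported n :=
  supported_mono (Set.image_mono (Set.Icc_subset_Icc_right h))

theorem totalD_mem_jetSupported {m : ℕ} {F : JetPoly} (hF : F ∈ jetSupported m) :
    totalD F ∈ jetSupported (m + 1) := by
  rw [jetSupported, supported_eq_adjoin_X] at hF
  have hle : jetSupported m ≤ jetSupported (m + 1) := jetSupported_mono m.le_succ
  refine (Algebra.adjoin_induction (p := fun F _ => F ∈ jetSupported m ∧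
    totalD F ∈ jetSupported (m + 1)) ?_ ?_ ?_ ?_ hF).2
  · rintro _ ⟨_, ⟨k, hk, rfl⟩, rfl⟩
    refine ⟨yc_mem_jetSupported hk.1 hk.2, ?_⟩
    change totalD (yc k) ∈ _
    rw [totalD_yc]
    exact yc_mem_jetSupported (hk.1.trans k.le_succ) (Nat.succ_le_succ hk.2)
  · intro a
    refine ⟨Subalgebra.algebraMap_mem _ a, ?_⟩
    rw [Derivation.map_algebraMap]
    exact zero_mem _
  · rintro F G _ _ ⟨hF, dF⟩ ⟨hG, dG⟩
    rw [map_add]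
    exact ⟨add_mem hF hG, add_mem dF dG⟩
  · rintro F G _ _ ⟨hF, dF⟩ ⟨hG, dG⟩
    rw [Derivation.leibniz, smul_eq_mul, smul_eq_mul]
    exact ⟨mul_mem hF hG, add_mem (mul_mem (hle hF) dG) (mul_mem (hle hG) dF)⟩

/-- `R` is `3 y₂ʲ y_{m+1}` up to a polynomial in `y₂, …, y_m`. -/
def HasLeading (j m : ℕ) (R : JetPoly) : Prop :=
  ∃ γ ∈ jetSupported m, R = 3 * yc 2 ^ j * yc (m + 1) + γ

theorem ofNat_mem_jetSupported (m n : ℕ) [n.AtLeastTwo] :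
    (ofNat(n) : JetPoly) ∈ jetSupported m := ofNat_mem _ n

theorem HasLeading.mem_jetSupported {j m : ℕ} {R : JetPoly} (h : HasLeading j m R) (hm : 1 ≤ m) :
    R ∈ jetSupported (m + 1) := by
  obtain ⟨γ, hγ, rfl⟩ := h
  exact add_mem (mul_mem (mul_mem (ofNat_mem_jetSupported _ 3)
    (pow_mem (yc_mem_jetSupported le_rfl (by omega)) j))
    (yc_mem_jetSupported (by omega) le_rfl)) (jetSupported_mono m.le_succ hγ)

/-- The bound m ≥ 2 keeps y₃, which arises when D_x hits y₂ʲ, among the variables of the remainder.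
-/
theorem HasLeading.totalD {j m : ℕ} {R : JetPoly} (h : HasLeading j m R) (hm : 2 ≤ m) :
    HasLeading j (m + 1) (totalD R) := by
  obtain ⟨γ, hγ, rfl⟩ := h
  have h3 : PlaneCurve.totalD (3 : JetPoly) = 0 := Derivation.map_natCast _ 3
  refine ⟨3 * PlaneCurve.totalD (yc 2 ^ j) * yc (m + 1) + PlaneCurve.totalD γ, ?_, ?_⟩
  · refine add_mem (mul_mem (mul_mem (ofNat_mem_jetSupported _ 3) ?_)
      (yc_mem_jetSupported (by omega) le_rfl)) (totalD_mem_jetSupported hγ)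
    exact jetSupported_mono (by omega : 2 + 1 ≤ m + 1)
      (totalD_mem_jetSupported (pow_mem (yc_mem_jetSupported le_rfl le_rfl) j))
  · have h3' : PlaneCurve.totalD (3 * yc 2 ^ j) = 3 * PlaneCurve.totalD (yc 2 ^ j) := by
      rw [Derivation.leibniz, h3, smul_zero, add_zero, smul_eq_mul]
    rw [map_add, Derivation.leibniz, h3', smul_eq_mul, smul_eq_mul, totalD_yc]
    ring

/-- Only y₂D_x²R reaches y_{m+3}; the other terms have order at most m + 2. -/
theorem HasLeading.secondOp {j m : ℕ} {R : JetPoly} (h : HasLeading j m R) (hm : 3 ≤ m) (w : ℤ) :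
    HasLeading (j + 1) (m + 2) (secondOp w R) := by
  have h1 := h.totalD (by omega)
  obtain ⟨γ, hγ, hR⟩ := h1.totalD (by omega)
  have hC : ∀ (a : ℂ) (n : ℕ), (C a : JetPoly) ∈ jetSupported n :=
    fun a n => Subalgebra.algebraMap_mem _ a
  have hZ : ∀ (a : ℤ) (n : ℕ), (a : JetPoly) ∈ jetSupported n := fun a n => intCast_mem _ a
  refine ⟨yc 2 * γ - C (1 / 45 : ℂ) * ((15 * (2 * w + 1) : ℤ) : JetPoly) * yc 3 *
    PlaneCurve.totalD R + C (1 / 45 : ℂ) * ((3 * (w * (w - 1)) : ℤ) : JetPoly) * yc 4 * R, ?_, ?_⟩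
  · refine add_mem (sub_mem (mul_mem (yc_mem_jetSupported le_rfl (by omega)) hγ)
      (mul_mem (mul_mem (mul_mem (hC _ _) (hZ _ _)) (yc_mem_jetSupported (by omega) (by omega)))
        (h1.mem_jetSupported (by omega))))
      (mul_mem (mul_mem (mul_mem (hC _ _) (hZ _ _)) (yc_mem_jetSupported (by omega) (by omega)))
        (jetSupported_mono (by omega) (h.mem_jetSupported (by omega))))
  · rw [PlaneCurve.secondOp, hR]
    push_cast
    ring

/-- The sequence `Q₄, Q₆, Q₈, …`, numbered from `0`. -/
noncomputable def qPoly : ℕ → JetPoly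
  | 0 => quartic
  -- With i = k + 2, the weight 5i - 2 is 5k + 8.
  | k + 1 => secondOp (5 * k + 8) (qPoly k)

theorem qPoly_mem (k : ℕ) : qPoly k ∈ relInv (5 * k + 8) := by
  induction k with
  | zero => exact quartic_mem
  | succ k ih =>
    have h := secondOp_mem ih
    rw [show (5 * (k : ℤ) + 8 + 5) = 5 * (k + 1 : ℕ) + 8 by push_cast; ring] at h
    exact h

theorem hasLeading_qPoly (k : ℕ) : HasLeading (k + 1) (2 * k + 3) (qPoly k) := by
  induction k with
  | zero =>
    refine ⟨-5 * yc 3 ^ 2, ?_, ?_⟩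
    · exact mul_mem (neg_mem (ofNat_mem_jetSupported _ 5))
        (pow_mem (yc_mem_jetSupported (by norm_num) le_rfl) 2)
    · simp only [qPoly, quartic]
      ring
  | succ k ih => exact ih.secondOp (by omega) _

/-- The relative invariants `Q_{2i}` for `i ≥ 2`, with junk values `0` below. -/
noncomputable def qSeq (i : ℕ) : relInv (5 * (i : ℤ) - 2) :=
  if h : 2 ≤ i then
    ⟨qPoly (i - 2), by
      have := qPoly_mem (i - 2)
      rwa [show 5 * ((i - 2 : ℕ) : ℤ) + 8 = 5 * (i : ℤ) - 2 by push_cast [h]; ring] at this⟩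
  else 0

theorem coe_qSeq_add_two (k : ℕ) : (qSeq (k + 2) : JetPoly) = qPoly k := by
  rw [qSeq, dif_pos (by omega)]
  rfl

theorem yc_two_mul_qPoly_succ (k : ℕ) :
    yc 2 * qPoly (k + 1) =
      totalOp (yc 2) (C (-(1 / 3 : ℂ)) * yc 3) (5 * ((k + 2 : ℕ) : ℤ) + 2)
        (totalOp (yc 2) (C (-(1 / 3 : ℂ)) * yc 3) (5 * ((k + 2 : ℕ) : ℤ) - 2) (qPoly k)) +
      C ((5 * ((k + 2 : ℕ) : ℂ) - 2) * (5 * ((k + 2 : ℕ) : ℂ) + 2) / 45) * qPoly 0 * qPoly k := by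
  rw [show 5 * ((k + 2 : ℕ) : ℤ) + 2 = 5 * k + 8 + 4 by push_cast; ring,
    show 5 * ((k + 2 : ℕ) : ℤ) - 2 = 5 * k + 8 by push_cast; ring]
  have h := yc_two_mul_secondOp (5 * k + 8) (qPoly k)
  rw [show (((5 * k + 8 : ℤ) : ℂ) * ((5 * k + 8 : ℤ) + 4) / 45) =
    (5 * ((k + 2 : ℕ) : ℂ) - 2) * (5 * ((k + 2 : ℕ) : ℂ) + 2) / 45 by push_cast; ring] at h
  exact h


/-! ### Scaling weights and the bound on the weight of a derivation -/

theorem iterate_totalD_yc (k j : ℕ) : totalD^[k] (yc j) = yc (j + k) := by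
  induction k with
  | zero => rfl
  | succ k ih => rw [Function.iterate_succ_apply', ih, totalD_yc, add_assoc]

theorem prolong_translation_x : prolong (1, 0) = pderiv none := by
  apply MvPolynomial.derivation_ext
  rintro (_ | k)
  · exact (prolong_xc _).trans (by simp [pderiv_X])
  · refine (prolong_yc _ k).trans ?_
    rw [mul_one, zero_sub, iterate_map_neg, iterate_totalD_yc, one_mul, add_comm,
      add_comm, add_comm 1 k, neg_add_cancel, pderiv_X_of_ne (by simp)]

theorem prolong_translation_y : prolong (0, 1) = pderiv (some 0) := by
  apply MvPolynomial.derivation_ext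
  rintro (_ | k)
  · exact (prolong_xc _).trans (by simp [pderiv_X])
  · refine (prolong_yc _ k).trans ?_
    rw [mul_zero, sub_zero, zero_mul, add_zero]
    cases k with
    | zero => simp
    | succ k =>
      rw [Function.iterate_succ_apply, Derivation.map_one_eq_zero, iterate_map_zero,
        pderiv_X_of_ne (by simp)]

theorem prolong_shear_x : prolong (0, xc) = xc • pderiv (some 0) + pderiv (some 1) := by
  apply MvPolynomial.derivation_ext
  rintro (_ | k)
  · exact (prolong_xc _).trans (by simp [pderiv_X])
  · refine (prolong_yc _ k).trans ?_
    rw [mul_zero, sub_zero, zero_mul, add_zero]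
    rcases k with _ | _ | k
    · simp [pderiv_X]
    · simp [pderiv_X]
    · rw [Function.iterate_succ_apply, totalD_xc, Function.iterate_succ_apply,
        Derivation.map_one_eq_zero, iterate_map_zero]
      simp [pderiv_X]

theorem saff_generators_mem : (1, 0) ∈ saff ∧ (0, 1) ∈ saff ∧ (0, xc) ∈ saff ∧
    (yc 0, 0) ∈ saff ∧ (xc, -yc 0) ∈ saff := by
  refine ⟨?_, ?_, ?_, ?_, ?_⟩ <;> exact Submodule.subset_span (by simp)

/-- `F` does not involve `x`, `y`, `y₁`. -/
def IsTransverse (F : JetPoly) : Prop :=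
  pderiv none F = 0 ∧ pderiv (some 0) F = 0 ∧ pderiv (some 1) F = 0

/-- The translations and the shear x∂_y have λ = 0 and prolong to ∂_x, ∂_y and x∂_y + ∂_{y₁}. -/
theorem isTransverse_of_mem {w : ℤ} {F : JetPoly} (hF : F ∈ relInv w) : IsTransverse F := by
  obtain ⟨c1, c2, c3, -, -⟩ := contactFactor_generators
  obtain ⟨m1, m2, m3, -, -⟩ := saff_generators_mem
  have h1 := mem_relInv_iff.1 hF _ m1
  have h2 := mem_relInv_iff.1 hF _ m2
  have h3 := mem_relInv_iff.1 hF _ m3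
  rw [c1, zero_mul, mul_zero, prolong_translation_x] at h1
  rw [c2, zero_mul, mul_zero, prolong_translation_y] at h2
  rw [c3, zero_mul, mul_zero, prolong_shear_x, Derivation.add_apply, Derivation.smul_apply, h2,
    smul_zero, zero_add] at h3
  exact ⟨h1, h2, h3⟩

theorem prolong_scaling_yc (k : ℕ) :
    prolong (xc, -yc 0) (yc k) = -((k + 1 : ℕ) : JetPoly) * yc k := by
  induction k with
  | zero =>
    rw [prolong_yc]
    simp only [Function.iterate_zero, id]
    push_cast
    ring
  | succ k ih =>
    have h0 : totalD (-((k + 1 : ℕ) : JetPoly)) = 0 := by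
      rw [map_neg, Derivation.map_natCast, neg_zero]
    rw [← totalD_yc, prolong_totalD, ih, Derivation.leibniz, h0, totalD_xc, totalD_yc]
    push_cast [smul_eq_mul]
    ring

/-- Monomials are eigenvectors of a diagonal derivation. -/
theorem coeff_mkDerivation_diagonal {σ : Type*} (a : σ → ℂ) (F : MvPolynomial σ ℂ) (s : σ →₀ ℕ) :
    coeff s (mkDerivation ℂ (fun i => a i • (X i : MvPolynomial σ ℂ)) F) =
      (s.sum fun i k => k * a i) * coeff s F := by
  induction F using MvPolynomial.induction_on' with
  | add p q hp hq => rw [map_add, coeff_add, coeff_add, hp, hq, mul_add]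
  | monomial t c =>
    have h : mkDerivation ℂ (fun i => a i • (X i : MvPolynomial σ ℂ)) (monomial t c) =
        monomial t ((t.sum fun i k => k * a i) * c) := by
      rw [mkDerivation_monomial, Finsupp.sum, Finsupp.sum, Finset.sum_mul, map_sum,
        Finset.smul_sum]
      refine Finset.sum_congr rfl fun i hi => ?_
      have hi' : Finsupp.single i 1 ≤ t := by
        rw [Finsupp.single_le_iff]
        exact Nat.one_le_iff_ne_zero.2 (Finsupp.mem_support_iff.1 hi)
      rw [smul_eq_mul, mul_smul_comm, X, monomial_mul, tsub_add_cancel_of_le hi', smul_monomial,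
        smul_monomial]
      congr 1
      simp only [smul_eq_mul]
      ring
    classical
    rw [h, coeff_monomial, coeff_monomial]
    split_ifs with hst
    · rw [hst]
    · rw [mul_zero]

theorem prolong_scaling_eq :
    prolong (xc, -yc 0) = mkDerivation ℂ fun c : JetCoord =>
      (c.elim 1 fun k => -((k + 1 : ℕ) : ℂ)) • (X c : JetPoly) := by
  apply MvPolynomial.derivation_ext
  rintro (_ | k)
  · exact (prolong_xc _).trans (by simp [xc])
  · refine (prolong_scaling_yc k).trans ?_
    rw [mkDerivation_X, Option.elim_some, smul_eq_C_mul, C_neg, map_natCast]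
    rfl

theorem eq_zero_of_coeff_ne_zero {σ : Type*} {i : σ} {F : MvPolynomial σ ℂ}
    (hF : pderiv i F = 0) {s : σ →₀ ℕ} (hs : coeff s F ≠ 0) : s i = 0 := by
  by_contra hi
  have hi' : Finsupp.single i 1 ≤ s := by
    rw [Finsupp.single_le_iff]
    exact Nat.one_le_iff_ne_zero.2 hi
  have h := coeff_pderiv (i := i) F (s - Finsupp.single i 1)
  rw [hF, coeff_zero, tsub_add_cancel_of_le hi'] at h
  rcases mul_eq_zero.1 h.symm with h | h
  · exact hs h
  · exact Nat.cast_add_one_ne_zero _ h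

/-- Monomials in `y₂, y₃, …` have weight `0` or at least `3`. -/
theorem weight_of_coeff_ne_zero {w : ℤ} {F : JetPoly} (hF : IsTransverse F)
    (hw : prolong (xc, -yc 0) F = -(w : JetPoly) * F) {s : JetCoord →₀ ℕ} (hs : coeff s F ≠ 0) :
    (s = 0 ∧ w = 0) ∨ (s ≠ 0 ∧ 3 ≤ w) := by
  obtain ⟨h1, h2, h3⟩ := hF
  have e1 := eq_zero_of_coeff_ne_zero h1 hs
  have e2 := eq_zero_of_coeff_ne_zero h2 hs
  have e3 := eq_zero_of_coeff_ne_zero h3 hs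
  have hsum : (w : ℤ) = ∑ i ∈ s.support, (s i * i.elim 0 (fun k => k + 1) : ℕ) := by
    have h := coeff_mkDerivation_diagonal (fun c : JetCoord => c.elim 1 fun k => -((k + 1 : ℕ) : ℂ))
      F s
    rw [← prolong_scaling_eq, hw, ← map_intCast (C : ℂ →+* JetPoly), ← C_neg, coeff_C_mul] at h
    have h := mul_right_cancel₀ hs h
    have h' : (w : ℂ) = ((∑ i ∈ s.support, (s i * i.elim 0 (fun k => k + 1) : ℕ) : ℕ) : ℂ) := by
      rw [← neg_inj, h, Finsupp.sum, Nat.cast_sum, ← Finset.sum_neg_distrib]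
      refine Finset.sum_congr rfl ?_
      rintro (_ | k) hi
      · exact absurd e1 (Finsupp.mem_support_iff.1 hi)
      · simp only [Option.elim_some]
        push_cast
        ring
    exact_mod_cast h'
  rcases eq_or_ne s 0 with rfl | h0
  · left
    simpa using hsum
  · right
    obtain ⟨i, hi⟩ := Finsupp.support_nonempty_iff.2 h0
    have hle : s i * i.elim 0 (fun k => k + 1) ≤
        ∑ i ∈ s.support, (s i * i.elim 0 (fun k => k + 1) : ℕ) :=
      Finset.single_le_sum (f := fun i : JetCoord => s i * i.elim 0 (fun k => k + 1))
        (fun _ _ => Nat.zero_le _) hi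
    have hpos : 1 ≤ s i := Nat.one_le_iff_ne_zero.2 (Finsupp.mem_support_iff.1 hi)
    have hge : 3 ≤ s i * i.elim 0 (fun k => k + 1) := by
      rcases i with _ | _ | _ | k
      · omega
      · omega
      · simp only [zero_add] at *
        omega
      · simp only [Option.elim_some]
        nlinarith
    exact ⟨h0, by omega⟩

theorem prolong_scaling_of_mem {w : ℤ} {F : JetPoly} (hF : F ∈ relInv w) :
    prolong (xc, -yc 0) F = -(w : JetPoly) * F := by
  obtain ⟨-, -, -, -, c5⟩ := contactFactor_generators
  obtain ⟨-, -, -, -, m5⟩ := saff_generators_mem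
  rw [mem_relInv_iff.1 hF _ m5, c5]
  ring

theorem isTransverse_cancel {P Q F : JetPoly} (hP : IsTransverse P) (hP0 : P ≠ 0)
    (hQ : IsTransverse Q) (h : Q = P * F) : IsTransverse F := by
  have key : ∀ i, pderiv i P = 0 → pderiv i Q = 0 → pderiv i F = 0 := by
    intro i h1 h2
    rw [h, Derivation.leibniz, h1, smul_zero, add_zero, smul_eq_mul] at h2
    exact (mul_eq_zero.1 h2).resolve_left hP0
  exact ⟨key _ hP.1 hQ.1, key _ hP.2.1 hQ.2.1, key _ hP.2.2 hQ.2.2⟩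

theorem isTransverse_yc {k : ℕ} (hk : 2 ≤ k) : IsTransverse (yc k) := by
  refine ⟨?_, ?_, ?_⟩ <;> refine pderiv_X_of_ne ?_
  · simp
  · simp; omega
  · simp; omega

theorem IsTransverse.mul {F G : JetPoly} (hF : IsTransverse F) (hG : IsTransverse G) :
    IsTransverse (F * G) := by
  obtain ⟨h1, h2, h3⟩ := hF
  obtain ⟨k1, k2, k3⟩ := hG
  refine ⟨?_, ?_, ?_⟩ <;> simp only [Derivation.leibniz, *, smul_zero, add_zero]

theorem IsTransverse.sub {F G : JetPoly} (hF : IsTransverse F) (hG : IsTransverse G) :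
    IsTransverse (F - G) := by
  obtain ⟨h1, h2, h3⟩ := hF
  obtain ⟨k1, k2, k3⟩ := hG
  refine ⟨?_, ?_, ?_⟩ <;> simp only [map_sub, *, sub_zero]

theorem isTransverse_ofNat (n : ℕ) [n.AtLeastTwo] : IsTransverse (ofNat(n) : JetPoly) :=
  ⟨Derivation.map_natCast _ n, Derivation.map_natCast _ n, Derivation.map_natCast _ n⟩

theorem totalOp_standard_quartic_ne_zero :
    totalOp (yc 2) (C (-(1 / 3 : ℂ)) * yc 3) 8 quartic ≠ 0 := by
  intro h
  have h3 : totalD (3 : JetPoly) = 0 := Derivation.map_natCast _ 3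
  have h5 : totalD (5 : JetPoly) = 0 := Derivation.map_natCast _ 5
  simp only [totalOp_eq, quartic, map_sub, Derivation.leibniz, smul_eq_mul, h3, h5, pow_two,
    totalD_yc] at h
  -- At the point y₂ = y₅ = 1, all else 0, only the term 3y₂²y₅ survives.
  have heval := congrArg (MvPolynomial.eval fun c : JetCoord =>
    if c = some 2 ∨ c = some 5 then (1 : ℂ) else 0) h
  simp [yc] at heval

/-- The coefficients of an operator that preserves the relative invariants, of weight `m`. -/
theorem coefficients_of_totalOp_mem {m : ℤ} {α β : JetPoly}
    (h : ∀ (w : ℤ) (R : JetPoly), R ∈ relInv w → totalOp α β w R ∈ relInv (w + m)) :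
    α ∈ relInv (m - 1) ∧ α * yc 3 + 3 * (yc 2 * β) ∈ relInv (3 + m) := by
  have hf : α * yc 3 + 3 * (yc 2 * β) ∈ relInv (3 + m) := by
    have := h 3 _ yc_two_mem
    rw [totalOp_eq, totalD_yc] at this
    convert this using 1
    push_cast
    ring
  refine ⟨?_, hf⟩
  -- Elimination of β: y₂(αD_x + 8β)Q₄ - (8/3)Q₄(αD_x + 3β)y₂ = α Δ(Q₄).
  apply mem_relInv_of_mul_mem (totalOp_standard_mem quartic_mem) totalOp_standard_quartic_ne_zero
  have hq := mul_mem_relInv yc_two_mem (h 8 _ quartic_mem)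
  have hfq := mul_mem_relInv hf quartic_mem
  rw [show 3 + (8 + m) = 8 + 4 + (m - 1) by ring] at hq
  rw [show 3 + m + 8 = 8 + 4 + (m - 1) by ring] at hfq
  have hC : (3 : JetPoly) * C (1 / 3 : ℂ) = 1 := by
    rw [← map_ofNat C 3, ← C_mul]
    norm_num
  have hN : (C (-(1 / 3 : ℂ)) : JetPoly) = -C (1 / 3 : ℂ) := C_neg _ _
  convert sub_mem hq (Submodule.smul_mem _ (8 / 3 : ℂ) hfq) using 1
  rw [show (8 / 3 : ℂ) = 8 * (1 / 3) by norm_num, smul_eq_C_mul, C_mul, map_ofNat, totalOp_eq,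
    totalOp_eq, hN]
  push_cast
  linear_combination (8 * yc 2 * β * quartic) * hC

theorem weight_or_coefficients {m : ℤ} {α β : JetPoly}
    (h : ∀ (w : ℤ) (R : JetPoly), R ∈ relInv w → totalOp α β w R ∈ relInv (w + m)) :
    4 ≤ m ∨ (α = 0 ∧ β ∈ relInv m) := by
  obtain ⟨hα, hf⟩ := coefficients_of_totalOp_mem h
  by_cases h0 : α = 0
  · right
    refine ⟨h0, mem_relInv_of_mul_mem yc_two_mem (yc_ne_zero 2) ?_⟩
    have h3 := Submodule.smul_mem _ (1 / 3 : ℂ) hf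
    convert h3 using 1
    rw [h0, ← map_ofNat C 3, ← smul_eq_C_mul, zero_mul, zero_add, smul_smul]
    norm_num
  left
  obtain ⟨s, hs⟩ := MvPolynomial.exists_coeff_ne_zero h0
  rcases weight_of_coeff_ne_zero (isTransverse_of_mem hα) (prolong_scaling_of_mem hα) hs with
    ⟨-, hm⟩ | ⟨-, hm⟩
  swap
  · omega
  exfalso
  obtain rfl : m = 1 := by omega
  -- For m = 1, scaling gives β weight 1, and β is transverse because 3y₂β is; no monomial in y₂,
  -- y₃, … has weight 1.
  have hβ : β = 0 := by
    by_contra hβ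
    obtain ⟨t, ht⟩ := MvPolynomial.exists_coeff_ne_zero hβ
    have hV : prolong (xc, -yc 0) β = -((1 : ℤ) : JetPoly) * β := by
      have e := prolong_scaling_of_mem hf
      have e3 : prolong (xc, -yc 0) (3 : JetPoly) = 0 := Derivation.map_natCast _ 3
      simp only [map_add, Derivation.leibniz, smul_eq_mul, e3, prolong_scaling_yc,
        prolong_scaling_of_mem hα] at e
      push_cast at e ⊢
      apply mul_left_cancel₀ (mul_ne_zero (by norm_num : (3 : JetPoly) ≠ 0) (yc_ne_zero 2))
      linear_combination e
    rcases weight_of_coeff_ne_zero (isTransverse_cancel ((isTransverse_ofNat 3).mul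
      (isTransverse_yc le_rfl)) (mul_ne_zero (by norm_num) (yc_ne_zero 2))
      ((isTransverse_of_mem hf).sub ((isTransverse_of_mem hα).mul
        (isTransverse_yc (by norm_num : 2 ≤ 3)))) (by ring)) hV ht with ⟨-, h⟩ | ⟨-, h⟩ <;> omega
  have hsub : α = C (coeff 0 α) := by
    ext t
    rw [coeff_C]
    split_ifs with ht
    · rw [ht]
    · by_contra hne
      rcases weight_of_coeff_ne_zero (isTransverse_of_mem hα) (prolong_scaling_of_mem hα) hne with
        ⟨h1, -⟩ | ⟨-, h1⟩
      · exact ht h1.symm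
      · omega
  rw [hβ, mul_zero, mul_zero, add_zero] at hf
  -- With α of weight 0 and αy₃ of weight 4, the field y∂_x gives a contradiction: its prolongation
  -- of y₃ has the extra term -3y₂².
  obtain ⟨-, -, -, c4, -⟩ := contactFactor_generators
  obtain ⟨-, -, -, m4, -⟩ := saff_generators_mem
  have h1 := mem_relInv_iff.1 hf _ m4
  have h2 := mem_relInv_iff.1 hα _ m4
  rw [Derivation.leibniz, h2, prolong_yc_three m4, c4, map_neg, totalD_yc] at h1
  push_cast [smul_eq_mul] at h1
  have h3 : α * (3 * yc 2 ^ 2) = 0 := by linear_combination -h1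
  rcases mul_eq_zero.1 h3 with h3 | h3
  · exact h0 h3
  · exact mul_ne_zero (by norm_num) (pow_ne_zero 2 (yc_ne_zero 2)) h3


/-! ### The slope condition on monomials y₂ᵃ y_n -/

/-- Restriction of a polynomial in the jet coordinates to the `y₂`-axis. -/
noncomputable def axisEval : JetPoly →ₐ[ℂ] Polynomial ℂ :=
  aeval fun c : JetCoord => if c = some 2 then Polynomial.X else 0

/-- The derivative in the direction of `y_n` along the `y₂`-axis. -/
noncomputable def axisCoeff (n : ℕ) (F : JetPoly) : Polynomial ℂ :=
  axisEval (pderiv (some n) F)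

theorem axisEval_yc_two : axisEval (yc 2) = Polynomial.X := by simp [axisEval, yc]

theorem axisEval_yc {k : ℕ} (hk : k ≠ 2) : axisEval (yc k) = 0 := by simp [axisEval, yc, hk]

theorem axisCoeff_add (n : ℕ) (F G : JetPoly) :
    axisCoeff n (F + G) = axisCoeff n F + axisCoeff n G := by
  simp only [axisCoeff, map_add]

theorem axisCoeff_mul (n : ℕ) (F G : JetPoly) :
    axisCoeff n (F * G) = axisEval F * axisCoeff n G + axisEval G * axisCoeff n F := by
  simp only [axisCoeff, Derivation.leibniz, map_add, smul_eq_mul, map_mul]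

theorem pderiv_totalD (n : ℕ) (F : JetPoly) :
    pderiv (some (n + 1)) (totalD F) =
      totalD (pderiv (some (n + 1)) F) + pderiv (some n) F := by
  have h : ⁅pderiv (R := ℂ) (some (n + 1)), totalD⁆ = pderiv (some n) := by
    apply MvPolynomial.derivation_ext
    rintro (_ | k)
    · rw [Derivation.commutator_apply]
      change pderiv _ (totalD xc) - totalD (pderiv _ (X none)) = _
      simp [pderiv_X]
    · rw [Derivation.commutator_apply]
      change pderiv _ (totalD (yc k)) - totalD (pderiv _ (X (some k))) = _
      rw [totalD_yc, yc, pderiv_X, pderiv_X, pderiv_X]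
      rcases eq_or_ne n k with rfl | hk
      · simp
      · by_cases hk' : k = n + 1 <;> simp [hk.symm, hk']
  have h2 := congrArg (fun d => d F) h
  rw [Derivation.commutator_apply] at h2
  linear_combination h2

/-- On the y₂-axis every coefficient of D_x vanishes except those of ∂_x and ∂_{y₁}. -/
theorem axisEval_totalD (F : JetPoly) :
    axisEval (totalD F) = axisEval (pderiv none F) + Polynomial.X * axisCoeff 1 F := by
  induction F using MvPolynomial.induction_on with
  | C a =>
    have h : totalD (C a) = 0 := Derivation.map_algebraMap _ _
    simp [h, axisCoeff]
  | add F G hF hG => simp only [map_add, hF, hG, axisCoeff_add]; ring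
  | mul_X F c hF =>
    have hc : axisEval (totalD (X c)) =
        axisEval (pderiv none (X c)) + Polynomial.X * axisCoeff 1 (X c) := by
      rcases c with _ | k
      · change axisEval (totalD xc) = _
        simp [axisCoeff, pderiv_X]
      · change axisEval (totalD (yc k)) = _
        rw [totalD_yc]
        rcases eq_or_ne k 1 with rfl | hk
        · simp [axisEval_yc_two, axisCoeff, pderiv_X]
        · rw [axisEval_yc (by omega), axisCoeff, pderiv_X_of_ne (by simp), pderiv_X_of_ne
            (by simpa using hk)]
          simp
    simp only [Derivation.leibniz, smul_eq_mul, map_add, map_mul, hF, hc, axisCoeff_mul]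
    ring

theorem pderiv_comm (i j : JetCoord) (F : JetPoly) :
    pderiv i (pderiv j F) = pderiv j (pderiv i F) := by
  have h : ⁅pderiv (R := ℂ) i, pderiv (R := ℂ) j⁆ = 0 := by
    apply MvPolynomial.derivation_ext
    intro k
    classical
    rw [Derivation.commutator_apply, pderiv_X, pderiv_X, Pi.single_apply, Pi.single_apply]
    split_ifs <;> simp
  have h2 := congrArg (fun d => d F) h
  rw [Derivation.commutator_apply] at h2
  exact sub_eq_zero.1 h2

theorem axisEval_totalD_eq_zero {F : JetPoly} (hF : IsTransverse F) : axisEval (totalD F) = 0 := by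
  rw [axisEval_totalD, axisCoeff, hF.1, hF.2.2, map_zero, mul_zero, add_zero]

/-- D_x commutes with ∂_{y_{n+1}} up to ∂_{y_n}, and D_x of a transverse polynomial vanishes on the
axis. -/
theorem axisCoeff_totalD {F : JetPoly} (hF : IsTransverse F) (n : ℕ) :
    axisCoeff (n + 1) (totalD F) = axisCoeff n F := by
  have h : IsTransverse (pderiv (some (n + 1)) F) := by
    refine ⟨?_, ?_, ?_⟩ <;> rw [pderiv_comm]
    · rw [hF.1, map_zero]
    · rw [hF.2.1, map_zero]
    · rw [hF.2.2, map_zero]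
  rw [axisCoeff, pderiv_totalD, map_add, axisEval_totalD_eq_zero h, zero_add]
  rfl

/-- The polynomials in which every monomial `y₂ᵃ y_n` with `n > K` has `n - a ≤ K`. -/
noncomputable def slopeSubalgebra (K : ℕ) : Subalgebra ℂ JetPoly where
  carrier := {F | ∀ n, K < n → Polynomial.X ^ (n - K) ∣ axisCoeff n F}
  add_mem' hF hG n hn := by
    rw [axisCoeff_add]
    exact dvd_add (hF n hn) (hG n hn)
  mul_mem' hF hG n hn := by
    rw [axisCoeff_mul]
    exact dvd_add ((hG n hn).mul_left _) ((hF n hn).mul_left _)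
  algebraMap_mem' a n _ := by
    rw [axisCoeff, Derivation.map_algebraMap, map_zero]
    exact dvd_zero _

theorem slopeSubalgebra_mono {K L : ℕ} (h : K ≤ L) : slopeSubalgebra K ≤ slopeSubalgebra L :=
  fun _ hF n hn => (pow_dvd_pow _ (by omega)).trans (hF n (by omega))

theorem exists_mem_slopeSubalgebra (F : JetPoly) : ∃ K, F ∈ slopeSubalgebra K := by
  obtain ⟨K, hK⟩ : ∃ K, ∀ k, some k ∈ F.vars → k ≤ K := by
    refine ⟨F.vars.sup fun c => c.elim 0 id, fun k hk => ?_⟩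
    exact Finset.le_sup (f := fun c : JetCoord => c.elim 0 id) hk
  refine ⟨K, fun n hn => ?_⟩
  rw [axisCoeff, pderiv_eq_zero_of_notMem_vars fun h => (hK n h).not_gt hn, map_zero]
  exact dvd_zero _

/-- Positive weight excludes a constant term. -/
theorem X_dvd_axisEval {m : ℤ} {α : JetPoly} (hm : 4 ≤ m) (hα : α ∈ relInv (m - 1)) :
    Polynomial.X ∣ axisEval α := by
  have h0 : coeff 0 α = 0 := by
    by_contra h
    rcases weight_of_coeff_ne_zero (isTransverse_of_mem hα) (prolong_scaling_of_mem hα) h with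
      ⟨-, h⟩ | ⟨h, -⟩
    · omega
    · exact h rfl
  have h1 : ∀ F : JetPoly, (axisEval F).coeff 0 = constantCoeff F := by
    intro F
    induction F using MvPolynomial.induction_on with
    | C a => simp [axisEval]
    | add F G hF hG => simp only [map_add, Polynomial.coeff_add, hF, hG]
    | mul_X F c hF =>
      rw [map_mul, map_mul, Polynomial.mul_coeff_zero, hF, constantCoeff_X, mul_zero, axisEval,
        aeval_X]
      split_ifs <;> simp
  rw [Polynomial.X_dvd_iff, h1]
  exact h0

/-- The index shift caused by D_x costs one power of y₂, which α supplies. Derivatives of α do not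
contribute, as D_x R vanishes on the axis. -/
theorem totalOp_mem_slopeSubalgebra {K : ℕ} (hK : 3 ≤ K) {α β R : JetPoly} {v w : ℤ}
    (hα : Polynomial.X ∣ axisEval α) (hβ : β ∈ slopeSubalgebra K) (hR : R ∈ relInv v)
    (hRK : R ∈ slopeSubalgebra K) : totalOp α β w R ∈ slopeSubalgebra K := by
  refine add_mem (fun n hn => ?_) (Subalgebra.smul_mem _ (mul_mem hβ hRK) _)
  have ht := isTransverse_of_mem hR
  obtain ⟨n, rfl⟩ : ∃ l, n = l + 1 := ⟨n - 1, by omega⟩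
  rw [axisCoeff_mul, axisEval_totalD_eq_zero ht, zero_mul, add_zero, axisCoeff_totalD ht,
    show n + 1 - K = 1 + (n - K) by omega, pow_add, pow_one]
  refine mul_dvd_mul hα ?_
  rcases (Nat.lt_succ_iff.1 hn).eq_or_lt with rfl | hn
  · rw [tsub_self, pow_zero]
    exact one_dvd _
  · exact hRK n hn

/-- The leading monomial y₂^{k+1} y_{2k+4} would need a factor y₂^{k+2}. -/
theorem qPoly_notMem_slopeSubalgebra (k : ℕ) : qPoly k ∉ slopeSubalgebra (k + 2) := by
  intro h
  obtain ⟨γ, hγ, hq⟩ := hasLeading_qPoly k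
  have h1 := h (2 * k + 3 + 1) (by omega)
  have h3 : (3 : JetPoly) = C 3 := (map_ofNat C 3).symm
  have hγ' : pderiv (some (2 * k + 3 + 1)) γ = 0 := by
    refine pderiv_eq_zero_of_notMem_vars fun hv => ?_
    obtain ⟨j, hj, hj'⟩ := mem_supported.1 hγ hv
    have := hj.2
    have := Option.some_injective _ hj'
    omega
  have hy : pderiv (some (2 * k + 3 + 1)) (yc 2) = 0 := pderiv_X_of_ne (by simp)
  have hy' : pderiv (some (2 * k + 3 + 1)) (yc (2 * k + 3 + 1)) = 1 := pderiv_X_self _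
  have h2 : axisCoeff (2 * k + 3 + 1) (qPoly k) =
      Polynomial.C 3 * Polynomial.X ^ (k + 1) := by
    rw [axisCoeff, hq, map_add, hγ', add_zero, Derivation.leibniz, hy', h3, pderiv_C_mul,
      Derivation.leibniz_pow, hy]
    simp only [smul_zero, mul_zero, add_zero, smul_eq_mul, mul_one, map_mul, map_pow,
      axisEval_yc_two]
    rw [axisEval, aeval_C]
    rfl
  rw [h2, Polynomial.X_pow_dvd_iff] at h1
  have h4 := h1 (k + 1) (by omega)
  simp at h4

/-- The elements of the graded algebra with all components in `slopeSubalgebra K`. -/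
noncomputable def gradedSlopeSubalgebra (K : ℕ) : Subalgebra ℂ RelInv where
  carrier := {a | ∀ w : ℤ, (a w : JetPoly) ∈ slopeSubalgebra K}
  add_mem' ha hb w := by
    rw [DirectSum.add_apply, Submodule.coe_add]
    exact add_mem (ha w) (hb w)
  mul_mem' {a b} ha hb w := by
    classical
    rw [DirectSum.coe_mul_apply]
    exact sum_mem fun ij _ => mul_mem (ha ij.1) (hb ij.2)
  algebraMap_mem' c w := by
    rw [DirectSum.algebraMap_apply]
    rcases eq_or_ne w 0 with rfl | hw
    · rw [DirectSum.of_eq_same]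
      exact Subalgebra.algebraMap_mem _ c
    · rw [DirectSum.of_eq_of_ne _ _ _ hw]
      exact zero_mem _

theorem homog_mem_gradedSlopeSubalgebra {K : ℕ} {w : ℤ} {R : relInv w} :
    homog w R ∈ gradedSlopeSubalgebra K ↔ (R : JetPoly) ∈ slopeSubalgebra K := by
  constructor
  · intro h
    have := h w
    rwa [homog, DirectSum.of_eq_same] at this
  · intro h v
    rcases eq_or_ne v w with rfl | hv
    · rwa [homog, DirectSum.of_eq_same]
    · rw [homog, DirectSum.of_eq_of_ne _ _ _ hv]
      exact zero_mem _

theorem gradedSlopeSubalgebra_mono {K L : ℕ} (h : K ≤ L) :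
    gradedSlopeSubalgebra K ≤ gradedSlopeSubalgebra L :=
  fun _ ha w => slopeSubalgebra_mono h (ha w)

theorem exists_mem_gradedSlopeSubalgebra (a : RelInv) : ∃ K, a ∈ gradedSlopeSubalgebra K := by
  induction a using DirectSum.induction_on with
  | zero => exact ⟨0, zero_mem _⟩
  | of w R =>
    obtain ⟨K, hK⟩ := exists_mem_slopeSubalgebra R
    exact ⟨K, homog_mem_gradedSlopeSubalgebra.2 hK⟩
  | add a b ha hb =>
    obtain ⟨K, hK⟩ := ha
    obtain ⟨L, hL⟩ := hb
    exact ⟨max K L, add_mem (gradedSlopeSubalgebra_mono (le_max_left _ _) hK)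
      (gradedSlopeSubalgebra_mono (le_max_right _ _) hL)⟩

theorem IsRelInvDerivation.totalOp_mem {m : ℤ} {α β : JetPoly} {δ : Derivation ℂ RelInv RelInv}
    (h : IsRelInvDerivation m α β δ) (w : ℤ) (R : JetPoly) (hR : R ∈ relInv w) :
    totalOp α β w R ∈ relInv (w + m) := (h w ⟨R, hR⟩).1

/-- Stability for all large K, not just one, allows a common K for finitely many derivations. -/
theorem IsRelInvDerivation.exists_forall_mem {m : ℤ} {α β : JetPoly}
    {δ : Derivation ℂ RelInv RelInv} (h : IsRelInvDerivation m α β δ) :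
    ∃ K₀, ∀ K, K₀ ≤ K → ∀ a ∈ gradedSlopeSubalgebra K, δ a ∈ gradedSlopeSubalgebra K := by
  obtain ⟨K₀, hβ⟩ := exists_mem_slopeSubalgebra β
  refine ⟨max 3 K₀, fun K hK a ha => ?_⟩
  have hα : Polynomial.X ∣ axisEval α := by
    rcases weight_or_coefficients h.totalOp_mem with hm | ⟨rfl, -⟩
    · exact X_dvd_axisEval hm (coefficients_of_totalOp_mem h.totalOp_mem).1
    · rw [map_zero]
      exact dvd_zero _
  classical
  rw [← DirectSum.sum_support_of a, map_sum]
  refine sum_mem fun w _ => ?_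
  obtain ⟨hmem, he⟩ := h w (a w)
  rw [homog] at he
  rw [he]
  exact homog_mem_gradedSlopeSubalgebra.2 (totalOp_mem_slopeSubalgebra
    ((le_max_left _ _).trans hK) hα (slopeSubalgebra_mono ((le_max_right _ _).trans hK) hβ)
    (a w).2 (ha w))

theorem exists_diffAdjoin_le {S : Set RelInv} {T : Set (Derivation ℂ RelInv RelInv)}
    (hS : S.Finite) (hT : T.Finite)
    (h : ∀ δ ∈ T, ∃ (m : ℤ) (α β : JetPoly), IsRelInvDerivation m α β δ) :
    ∃ K₀, ∀ K, K₀ ≤ K → diffAdjoin S T ≤ gradedSlopeSubalgebra K := by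
  choose k hk using exists_mem_gradedSlopeSubalgebra
  have hT' : ∀ δ, ∃ K₀, δ ∈ T → ∀ K, K₀ ≤ K → ∀ a ∈ gradedSlopeSubalgebra K,
      δ a ∈ gradedSlopeSubalgebra K := by
    intro δ
    by_cases hδ : δ ∈ T
    · obtain ⟨m, α, β, hm⟩ := h δ hδ
      obtain ⟨K₀, hK₀⟩ := hm.exists_forall_mem
      exact ⟨K₀, fun _ => hK₀⟩
    · exact ⟨0, fun h => absurd h hδ⟩
  choose l hl using hT'
  obtain ⟨A, hA⟩ := (hS.image k).bddAbove
  obtain ⟨B, hB⟩ := (hT.image l).bddAbove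
  refine ⟨max A B, fun K hK => sInf_le ⟨fun a ha => ?_, fun δ hδ => ?_⟩⟩
  · exact gradedSlopeSubalgebra_mono
      ((hA (Set.mem_image_of_mem k ha)).trans ((le_max_left _ _).trans hK)) (hk a)
  · exact hl δ hδ K ((hB (Set.mem_image_of_mem l hδ)).trans ((le_max_right _ _).trans hK))

end PlaneCurve

theorem mainTheorem2 :
    -- the derivation `Δ_w = y_2 D_x - (w/3) y_3`, of weight 4
    (∃ δ : Derivation ℂ RelInv RelInv,
      IsRelInvDerivation 4 (yc 2) (C (-(1 / 3 : ℂ)) * yc 3) δ) ∧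
    -- derivations that involve `D_x` have weight at least 4; all others are `R ↦ w β R`
    (∀ (m : ℤ) (α β : JetPoly) (δ : Derivation ℂ RelInv RelInv),
      IsRelInvDerivation m α β δ → 4 ≤ m ∨ (α = 0 ∧ β ∈ relInv m)) ∧
    -- the sequence `Q i = Q_{2i}`, `i ≥ 2`
    ∃ Q : (i : ℕ) → relInv (5 * (i : ℤ) - 2),
      (Q 2 : JetPoly) = 3 * yc 2 * yc 4 - 5 * yc 3 ^ 2 ∧
      (∀ i : ℕ, 2 ≤ i →
        yc 2 * (Q (i + 1) : JetPoly) =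
          totalOp (yc 2) (C (-(1 / 3 : ℂ)) * yc 3) (5 * (i : ℤ) + 2)
            (totalOp (yc 2) (C (-(1 / 3 : ℂ)) * yc 3) (5 * (i : ℤ) - 2) (Q i)) +
          C ((5 * (i : ℂ) - 2) * (5 * (i : ℂ) + 2) / 45) * (Q 2 : JetPoly) * (Q i : JetPoly)) ∧
      (∀ i : ℕ, 2 ≤ i →
        ∃ γ ∈ MvPolynomial.supported ℂ ((some : ℕ → JetCoord) '' Set.Icc 2 (2 * i - 1)),
          (Q i : JetPoly) = 3 * yc 2 ^ (i - 1) * yc (2 * i) + γ) ∧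
      -- failure of finite generation
      (∀ (S : Set RelInv) (T : Set (Derivation ℂ RelInv RelInv)), S.Finite → T.Finite →
        (∀ δ ∈ T, ∃ (m : ℤ) (α β : JetPoly), IsRelInvDerivation m α β δ) →
        (∃ i : ℕ, 2 ≤ i ∧ homog (5 * (i : ℤ) - 2) (Q i) ∉ diffAdjoin S T) ∧
        diffAdjoin S T ≠ ⊤) := by
  refine ⟨⟨_, isRelInvDerivation_standardDerivation⟩,
    fun m α β δ h => weight_or_coefficients h.totalOp_mem, qSeq, ?_, ?_, ?_, ?_⟩
  · exact coe_qSeq_add_two 0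
  · intro i hi
    obtain ⟨k, rfl⟩ : ∃ k, i = k + 2 := ⟨i - 2, by omega⟩
    rw [coe_qSeq_add_two (k + 1), coe_qSeq_add_two,
      show (qSeq 2 : JetPoly) = qPoly 0 from coe_qSeq_add_two 0]
    exact yc_two_mul_qPoly_succ k
  · intro i hi
    obtain ⟨k, rfl⟩ : ∃ k, i = k + 2 := ⟨i - 2, by omega⟩
    rw [coe_qSeq_add_two]
    exact hasLeading_qPoly k
  · intro S T hS hT h
    obtain ⟨K, hK⟩ := exists_diffAdjoin_le hS hT h
    -- The invariant with i = K + 2 violates the slope bound K + 2, which is still admissible since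
    -- it exceeds K.
    have hQ : homog (5 * ((K + 2 : ℕ) : ℤ) - 2) (qSeq (K + 2)) ∉ diffAdjoin S T := by
      intro hmem
      have h1 := homog_mem_gradedSlopeSubalgebra.1 (hK (K + 2) (by omega) hmem)
      rw [coe_qSeq_add_two] at h1
      exact qPoly_notMem_slopeSubalgebra K h1
    refine ⟨⟨K + 2, by omega, hQ⟩, fun htop => hQ ?_⟩
    rw [htop]
    exact Algebra.mem_top
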